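/- Graphs are finite and simple, $\log$ is the logarithm in base $2$, and $\log 0$ is read as $0$ (this matters only for graphs without edges, for which both widths below are $0$). A decomposition tree of a graph $G$ is a pair $(T,\delta)$, where $T$ is a tree all of whose internal nodes have degree three and $\delta$ is a bijection from $V(G)$ to the leaves of $T$ (the one-node tree has one leaf). Removing an edge $uv$ of $T$ splits the leaves, and hence $V(G)$, into two parts $X_u,X_v$. For a symmetric function $f:2^{V(G)}\to\mathbb{R}$, the $f$-width of $(T,\delta)$ is the maximum of $f(X_u)$ over the edges $uv$ of $T$ (it is $0$ if $T$ has no edge), and the $f$-width of $G$ is the minimum $f$-width of a decomposition tree of $G$ (it is $0$ if $G$ has no vertices). For $A\subseteq V(G)$ and $B=V(G)\setminus A$ let $$\beta_G(A)=\log\bigl|\{X\subseteq A : \exists\, Y\subseteq B,\ N(Y)\setminus B=X\}\bigr|,\qquad N(Y)=\bigcup_{y\in Y}N(y),$$ and let $\rho_G(A)$ be the logarithm of the number of vectors spanned over $GF(2)$ by the rows of the $A\times B$ submatrix of the adjacency matrix of $G$. The boolean-width $\beta w(G)$ is the $\beta_G$-width of $G$, and the rank-width $rw(G)$ is the $\rho_G$-width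 of $G$. For $p,q\ge 2$ the Hsu-grid $HG_{p,q}$ has vertices $v_{i,j}$ ($1\le i\le p$, $1\le j\le q$), and its edges are $v_{i,j}v_{i+1,j}$ for $1\le i<p$, $1\le j\le q$, and $v_{i,j}v_{i',j+1}$ for $1\le i\le i'\le p$, $1\le j<q$. **Theorem.** For every graph $G$, $$\log rw(G)\ \le\ \beta w(G)\ \le\ \tfrac14\, rw(G)^2+\tfrac54\, rw(G)+\log rw(G).$$ Moreover, for every sufficiently large integer $k$: 1. there is a Hsu-grid $L_k$ with $rw(L_k)\ge k$ and $\beta w(L_k)\le 2\log rw(L_k)+4$; 2. there is a square grid $U_k$ with $rw(U_k)\ge k$ and $\beta w(U_k)\ge\lfloor\tfrac16\, rw(U_k)\rfloor-1$; 3. the $k\times k$ grid $W_k$ itself satisfies $\beta w(W_k)\ge\lfloor\tfrac16\, rw(W_k)\rfloor-1$. -/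

import Mathlib

/-- A decomposition tree of a graph with vertex set `V`: a finite unrooted tree all of whose internal
nodes have degree three, together with a bijection from `V` to its leaves. A node is a leaf if it has
at most one neighbour, so the tree with a single node has exactly one leaf. -/
structure DecompositionTree (V : Type*) where
  /-- the nodes of the tree -/
  Node : Type
  finite_node : Finite Node
  /-- the tree -/
  tree : SimpleGraph Node
  isTree : tree.IsTree
  subcubic : ∀ t : Node, (tree.neighborSet t).ncard ≤ 1 ∨ (tree.neighborSet t).ncard = 3
  /-- the bijection between the vertices and the leaves -/
  leaf : V ≃ {t : Node // (tree.neighborSet t).ncard ≤ 1}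

namespace DecompositionTree

variable {V : Type*}

/-- The set of vertices of the graph whose leaves lie in the same component as `u` after the edge
`uv` has been removed from the tree. -/
def side (D : DecompositionTree V) (u v : D.Node) : Set V :=
  {x | (D.tree.deleteEdges {s(u, v)}).Reachable u (D.leaf x)}

/-- The `f`-width of a decomposition tree: the maximum of `f (D.side u v)` over the edges `uv` of the
tree. Both orientations of every edge are listed, which makes no difference for symmetric `f`. The
width of a tree without edges is `0`. -/
noncomputable def width (D : DecompositionTree V) (f : Set V → ℝ) : ℝ :=
  sSup {r : ℝ | ∃ u v : D.Node, D.tree.Adj u v ∧ r = f (D.side u v)}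

end DecompositionTree

/-- The `f`-width of a graph with vertex set `V`: the minimum `f`-width of its decomposition trees.
For finite `V` only finitely many values occur, so the infimum is a minimum as soon as `V` is
non-empty; the graph without vertices has no decomposition tree and gets width `0`. -/
noncomputable def cutFunctionWidth {V : Type*} (f : Set V → ℝ) : ℝ :=
  sInf {r : ℝ | ∃ D : DecompositionTree V, r = D.width f}

namespace SimpleGraph

variable {V : Type*}

/-- The union `N(Y)` of the neighbourhoods of the vertices in `Y`. -/
def unionNeighborSet (G : SimpleGraph V) (Y : Set V) : Set V :=
  ⋃ y ∈ Y, G.neighborSet y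

/-- The boolean-cut function: the base-two logarithm of the number of subsets `X` of `A` that are of
the form `N(Y) \ B` with `Y ⊆ B`, where `B` is the complement of `A`. -/
noncomputable def booleanCut (G : SimpleGraph V) (A : Set V) : ℝ :=
  Real.logb 2 ({X : Set V | X ⊆ A ∧ ∃ Y ⊆ Aᶜ, G.unionNeighborSet Y \ Aᶜ = X}.ncard)

/-- The boolean-width of a graph. -/
noncomputable def booleanWidth (G : SimpleGraph V) : ℝ :=
  cutFunctionWidth G.booleanCut

open Classical in
/-- The submatrix of the adjacency matrix over the field with two elements that has the rows indexed
by `A` and the columns indexed by the complement of `A`. -/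
noncomputable def cutMatrix (G : SimpleGraph V) (A : Set V) : Matrix A (Aᶜ : Set V) (ZMod 2) :=
  (G.adjMatrix (ZMod 2)).submatrix Subtype.val Subtype.val

/-- The cut-rank function: the base-two logarithm of the number of vectors that are spanned over the
field with two elements by the rows of the cut matrix. -/
noncomputable def cutRank (G : SimpleGraph V) (A : Set V) : ℝ :=
  Real.logb 2 (Nat.card (Submodule.span (ZMod 2) (Set.range (G.cutMatrix A).row)))

/-- The rank-width of a graph. -/
noncomputable def rankWidth (G : SimpleGraph V) : ℝ :=
  cutFunctionWidth G.cutRank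

/-- The Hsu-grid with `p` rows and `q` columns. The vertex `(i, j)` is in row `i` and column `j`; it is
adjacent to the next vertex of its column and to all vertices of the next column whose row is `i` or
greater than `i`. -/
def hsuGrid (p q : ℕ) : SimpleGraph (Fin p × Fin q) :=
  SimpleGraph.fromRel fun x y =>
    (x.1.val + 1 = y.1.val ∧ x.2 = y.2) ∨ (x.1 ≤ y.1 ∧ x.2.val + 1 = y.2.val)

/-- The square grid with `n` rows and `n` columns. -/
def squareGrid (n : ℕ) : SimpleGraph (Fin n × Fin n) :=
  (SimpleGraph.pathGraph n).boxProd (SimpleGraph.pathGraph n)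

end SimpleGraph

/-! Both inequalities already hold cut by cut, so each is transferred along a single decomposition
tree. The rank of a cut is at most its number of distinct columns, and over GF(2) the supports of
the columns are traces of single vertices: `cutRank_le_two_rpow_booleanCut`. Conversely, a trace
depends only on the span of the columns chosen, and a space of dimension r over GF(2) has at most
2^(r + r²/4) subspaces: `booleanCut_le`.

For lower bounds on grids, sample every other column and take a tree edge that splits one row of the
sample in a balanced way (`exists_adj_balanced`). Either a third of the sampled columns meet both
sides, or one column lies inside and another outside, and then every row meets both sides
(`mixed_or_pure`). In the square grid both cases give an induced matching, which bounds both cut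
functions linearly in n. In the Hsu-grid the second case gives one crossing edge per row, and these
edges form a triangular matrix (`le_hsuGrid_cutRank_of_pure`).

Upper bounds come from caterpillars, whose cuts are single vertices and segments of a linear order.
For the Hsu-grid ordered by columns, a trace is described by two thresholds and one bit
(`hsuGrid_cutTraces_ncard_le`). -/

namespace SimpleGraph

/-! ### The two cut functions -/

variable {V : Type*} (G : SimpleGraph V)

/-- The traces on `A` of the neighbourhoods of sets of vertices outside `A`. -/
def cutTraces (A : Set V) : Set (Set V) :=
  {X : Set V | X ⊆ A ∧ ∃ Y ⊆ Aᶜ, G.unionNeighborSet Y \ Aᶜ = X}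

lemma booleanCut_eq_logb_ncard (A : Set V) :
    G.booleanCut A = Real.logb 2 ((G.cutTraces A).ncard) := rfl

lemma mem_unionNeighborSet_diff_compl {A Y : Set V} {x : V} :
    x ∈ G.unionNeighborSet Y \ Aᶜ ↔ x ∈ A ∧ ∃ y ∈ Y, G.Adj y x := by
  simp [unionNeighborSet, and_comm]

lemma unionNeighborSet_diff_compl_mem_cutTraces {A Y : Set V} (hY : Y ⊆ Aᶜ) :
    G.unionNeighborSet Y \ Aᶜ ∈ G.cutTraces A :=
  ⟨fun _ hx => ((G.mem_unionNeighborSet_diff_compl).1 hx).1, Y, hY, rfl⟩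

lemma cutMatrix_ne_zero {A : Set V} {x : A} {y : (Aᶜ : Set V)} :
    G.cutMatrix A x y ≠ 0 ↔ G.Adj x y := by
  simp [cutMatrix, adjMatrix_apply]

section FiniteVertices

variable [Finite V]

lemma cutTraces_ncard_pos (A : Set V) : 0 < (G.cutTraces A).ncard :=
  (Set.ncard_pos (Set.toFinite _)).2
    ⟨_, G.unionNeighborSet_diff_compl_mem_cutTraces (Set.empty_subset Aᶜ)⟩

lemma booleanCut_nonneg (A : Set V) : 0 ≤ G.booleanCut A :=
  Real.logb_nonneg one_lt_two (by exact_mod_cast G.cutTraces_ncard_pos A)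

lemma two_rpow_booleanCut (A : Set V) :
    (2 : ℝ) ^ G.booleanCut A = (G.cutTraces A).ncard :=
  Real.rpow_logb two_pos (by norm_num) (by exact_mod_cast G.cutTraces_ncard_pos A)

/-- Sending X to the trace of the complementary set `Aᶜ \ X` is injective: a vertex of A misses the
image exactly when its neighbours in `Aᶜ` all lie in X, and X is the union of the neighbourhoods of
such vertices. -/
lemma cutTraces_ncard_compl_le (A : Set V) :
    (G.cutTraces Aᶜ).ncard ≤ (G.cutTraces A).ncard := by
  refine Set.ncard_le_ncard_of_injOn (fun X => G.unionNeighborSet (Aᶜ \ X) \ Aᶜ) ?_ ?_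
    (Set.toFinite _)
  · intro X _
    exact G.unionNeighborSet_diff_compl_mem_cutTraces Set.sdiff_subset
  · have key : ∀ X ∈ G.cutTraces Aᶜ, ∀ X' ∈ G.cutTraces Aᶜ,
        G.unionNeighborSet (Aᶜ \ X) \ Aᶜ = G.unionNeighborSet (Aᶜ \ X') \ Aᶜ → X ⊆ X' := by
      rintro X ⟨hXA, Y, hY, rfl⟩ X' ⟨hX'A, Y', hY', rfl⟩ h x hx
      obtain ⟨hxA, y, hyY, hyx⟩ := (G.mem_unionNeighborSet_diff_compl).1 hx
      by_contra hx'
      have hyA : y ∈ A := by simpa using hY hyY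
      have hy : y ∈ G.unionNeighborSet (Aᶜ \ (G.unionNeighborSet Y' \ Aᶜᶜ)) \ Aᶜ :=
        (G.mem_unionNeighborSet_diff_compl).2 ⟨hyA, x, ⟨hxA, hx'⟩, hyx.symm⟩
      rw [← h] at hy
      obtain ⟨-, z, ⟨hzA, hz⟩, hzy⟩ := (G.mem_unionNeighborSet_diff_compl).1 hy
      exact hz ((G.mem_unionNeighborSet_diff_compl).2 ⟨hzA, y, hyY, hzy.symm⟩)
    intro X hX X' hX' h
    exact (key X hX X' hX' h).antisymm (key X' hX' X hX h.symm)

lemma booleanCut_compl (A : Set V) : G.booleanCut Aᶜ = G.booleanCut A := by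
  have h := G.cutTraces_ncard_compl_le Aᶜ
  rw [compl_compl] at h
  rw [booleanCut_eq_logb_ncard, booleanCut_eq_logb_ncard,
    (G.cutTraces_ncard_compl_le A).antisymm h]

lemma booleanCut_singleton_le (x : V) : G.booleanCut {x} ≤ 1 := by
  have h : (G.cutTraces {x}).ncard ≤ 2 := by
    refine (Set.ncard_le_ncard (t := {∅, {x}}) ?_ (Set.toFinite _)).trans ?_
    · rintro X ⟨hX, -⟩
      simpa using Set.subset_singleton_iff_eq.1 hX
    · exact (Set.ncard_insert_le _ _).trans (by simp)
  rw [booleanCut_eq_logb_ncard, Real.logb_le_iff_le_rpow one_lt_two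
    (by exact_mod_cast G.cutTraces_ncard_pos _)]
  simpa using (by exact_mod_cast h : ((G.cutTraces {x}).ncard : ℝ) ≤ 2)

/-- An induced matching across a cut bounds the boolean-cut function from below. -/
lemma card_le_booleanCut {ι : Type*} [Finite ι] {A : Set V} (a b : ι → V)
    (ha : ∀ i, a i ∈ A) (hb : ∀ i, b i ∈ Aᶜ) (hab : ∀ i j, G.Adj (a i) (b j) ↔ i = j) :
    (Nat.card ι : ℝ) ≤ G.booleanCut A := by
  have h : 2 ^ Nat.card ι ≤ (G.cutTraces A).ncard := by
    have h1 : (Set.univ : Set (Set ι)).ncard = 2 ^ Nat.card ι := by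
      have := Fintype.ofFinite ι
      rw [Set.ncard_univ, Nat.card_eq_fintype_card, Fintype.card_set, Nat.card_eq_fintype_card]
    rw [← h1]
    have hmem : ∀ (Z : Set ι) (i : ι), a i ∈ G.unionNeighborSet (b '' Z) \ Aᶜ ↔ i ∈ Z := by
      intro Z i
      rw [mem_unionNeighborSet_diff_compl]
      constructor
      · rintro ⟨-, _, ⟨j, hj, rfl⟩, hadj⟩
        rwa [(hab i j).1 hadj.symm]
      · exact fun hi => ⟨ha i, b i, ⟨i, hi, rfl⟩, ((hab i i).2 rfl).symm⟩
    refine Set.ncard_le_ncard_of_injOn (fun Z => G.unionNeighborSet (b '' Z) \ Aᶜ) ?_ ?_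
      (Set.toFinite _)
    · intro Z _
      refine G.unionNeighborSet_diff_compl_mem_cutTraces ?_
      rintro _ ⟨i, _, rfl⟩
      exact hb i
    · intro Z _ Z' _ h
      ext i
      rw [← hmem Z i, ← hmem Z' i]
      exact iff_of_eq (congrArg (a i ∈ ·) h)
  rw [booleanCut_eq_logb_ncard, Real.le_logb_iff_rpow_le one_lt_two
    (by exact_mod_cast G.cutTraces_ncard_pos _), Real.rpow_natCast]
  exact_mod_cast h

lemma cutRank_eq_finrank_row (A : Set V) : G.cutRank A =
    Module.finrank (ZMod 2) (Submodule.span (ZMod 2) (Set.range (G.cutMatrix A).row)) := by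
  have := Fintype.ofFinite (Submodule.span (ZMod 2) (Set.range (G.cutMatrix A).row))
  rw [cutRank, Nat.card_eq_fintype_card, Module.card_eq_pow_finrank (K := ZMod 2), ZMod.card]
  push_cast
  rw [Real.logb_pow, Real.logb_self_eq_one one_lt_two, mul_one]

lemma cutRank_eq_rank (A : Set V) [Fintype (Aᶜ : Set V)] :
    G.cutRank A = (G.cutMatrix A).rank := by
  rw [cutRank_eq_finrank_row, Matrix.rank_eq_finrank_span_row]

lemma cutRank_eq_finrank_col (A : Set V) : G.cutRank A =
    Module.finrank (ZMod 2) (Submodule.span (ZMod 2) (Set.range (G.cutMatrix A).col)) := by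
  have := Fintype.ofFinite (Aᶜ : Set V)
  rw [cutRank_eq_rank, Matrix.rank_eq_finrank_span_cols]

lemma cutRank_compl (A : Set V) : G.cutRank Aᶜ = G.cutRank A := by
  classical
  have := Fintype.ofFinite V
  have h : G.cutMatrix Aᶜ = (G.cutMatrix A).transpose.submatrix (Equiv.refl _)
      (Equiv.setCongr (compl_compl A)) := by
    ext x y
    simp [cutMatrix, adjMatrix_apply]
  rw [cutRank_eq_rank, cutRank_eq_rank, h, Matrix.rank_submatrix, Matrix.rank_transpose]

/-- The cut-rank is at most the number of vertices outside `A` that have a neighbour in `A`. -/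
lemma cutRank_le_ncard {A S : Set V} (hS : ∀ x ∈ A, ∀ y ∈ Aᶜ, G.Adj x y → y ∈ S) :
    G.cutRank A ≤ S.ncard := by
  classical
  have := Fintype.ofFinite V
  rw [cutRank_eq_finrank_col]
  -- Extended by zero, so that S may contain vertices of A.
  set c : V → (A → ZMod 2) := fun y => if h : y ∈ Aᶜ then (G.cutMatrix A).col ⟨y, h⟩ else 0
  have hle : Submodule.span (ZMod 2) (Set.range (G.cutMatrix A).col) ≤
      Submodule.span (ZMod 2) (c '' S) := by
    rw [Submodule.span_le]
    rintro _ ⟨y, rfl⟩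
    by_cases hy : (y : V) ∈ S
    · exact Submodule.subset_span ⟨y, hy, dif_pos y.2⟩
    · have : (G.cutMatrix A).col y = 0 := by
        ext x
        by_contra hne
        exact hy (hS x x.2 y y.2 (G.cutMatrix_ne_zero.1 hne))
      rw [this]
      exact Submodule.zero_mem _
  have h1 := Submodule.finrank_mono hle
  have h2 := finrank_span_le_card (R := ZMod 2) (c '' S)
  rw [← Set.ncard_eq_toFinset_card'] at h2
  exact_mod_cast h1.trans (h2.trans (Set.ncard_image_le (Set.toFinite _)))

/-- A triangular family of edges across a cut bounds the cut-rank from below. -/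
lemma card_le_cutRank {ι : Type*} [Finite ι] {A : Set V} (a b : ι → V) (key : ι → ℤ)
    (ha : ∀ i, a i ∈ A) (hb : ∀ i, b i ∈ Aᶜ) (hab : ∀ i, G.Adj (a i) (b i))
    (hkey : ∀ i j, i ≠ j → G.Adj (a i) (b j) → key j < key i) :
    (Nat.card ι : ℝ) ≤ G.cutRank A := by
  classical
  have := Fintype.ofFinite ι
  have := Fintype.ofFinite V
  have hli : LinearIndependent (ZMod 2) fun i => (G.cutMatrix A).row ⟨a i, ha i⟩ := by
    rw [Fintype.linearIndependent_iff]
    intro c hc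
    by_contra! hne
    obtain ⟨i₀, hi₀⟩ := hne
    -- In a vanishing combination, take the largest key with a nonzero coefficient: in the column of
    -- `b i` every other row of the combination has entry 0.
    obtain ⟨i, hi, hmax⟩ := Finset.exists_max_image (Finset.univ.filter fun i => c i ≠ 0) key
      ⟨i₀, by simpa using hi₀⟩
    have hi' : c i ≠ 0 := by simpa using hi
    have h := congrFun hc ⟨b i, hb i⟩
    rw [Finset.sum_apply, Finset.sum_eq_single i] at h
    · have h' : c i * G.cutMatrix A ⟨a i, ha i⟩ ⟨b i, hb i⟩ = 0 := h
      rcases mul_eq_zero.1 h' with h' | h'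
      · exact hi' h'
      · exact G.cutMatrix_ne_zero.2 (by exact hab i) h'
    · intro j _ hji
      by_contra hz
      have hcj : c j ≠ 0 := by
        rintro h0
        simp [h0] at hz
      have hadj : G.Adj (a j) (b i) := by
        refine (G.cutMatrix_ne_zero (A := A) (x := ⟨a j, ha j⟩) (y := ⟨b i, hb i⟩)).1 ?_
        intro h0
        apply hz
        simp [Matrix.row, h0]
      exact absurd (hmax j (by simpa using hcj)) (not_le.2 (hkey j i hji hadj))
    · simp
  have hle : Submodule.span (ZMod 2) (Set.range fun i => (G.cutMatrix A).row ⟨a i, ha i⟩) ≤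
      Submodule.span (ZMod 2) (Set.range (G.cutMatrix A).row) := by
    refine Submodule.span_mono ?_
    rintro _ ⟨i, rfl⟩
    exact ⟨_, rfl⟩
  have h1 := Submodule.finrank_mono hle
  rw [finrank_span_eq_card hli] at h1
  rw [cutRank_eq_finrank_row, Nat.card_eq_fintype_card]
  exact_mod_cast h1

lemma card_le_cutRank_of_induced_matching {ι : Type*} [Finite ι] {A : Set V} (a b : ι → V)
    (ha : ∀ i, a i ∈ A) (hb : ∀ i, b i ∈ Aᶜ) (hab : ∀ i j, G.Adj (a i) (b j) ↔ i = j) :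
    (Nat.card ι : ℝ) ≤ G.cutRank A :=
  G.card_le_cutRank a b 0 ha hb (fun i => (hab i i).2 rfl)
    fun i j hij h => absurd ((hab i j).1 h) hij

lemma cutRank_singleton_le (x : V) : G.cutRank {x} ≤ 1 := by
  rw [← cutRank_compl]
  simpa using G.cutRank_le_ncard (A := {x}ᶜ) (S := {x}) (by simp)

/-- The rank is at most the number of distinct columns. The support of column y is the trace of
`{y}`, and a vector over GF(2) is determined by its support. -/
lemma cutRank_le_two_rpow_booleanCut (A : Set V) : G.cutRank A ≤ 2 ^ G.booleanCut A := by
  classical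
  have := Fintype.ofFinite V
  rw [two_rpow_booleanCut, cutRank_eq_finrank_col]
  have h := finrank_span_le_card (R := ZMod 2) (Set.range (G.cutMatrix A).col)
  rw [← Set.ncard_eq_toFinset_card'] at h
  refine Nat.cast_le.2 (h.trans ?_)
  refine Set.ncard_le_ncard_of_injOn (fun w => {v | ∃ h : v ∈ A, w ⟨v, h⟩ ≠ 0}) ?_ ?_
    (Set.toFinite _)
  · rintro _ ⟨y, rfl⟩
    refine ⟨fun v hv => hv.1, {(y : V)}, by simp, ?_⟩
    ext v
    rw [mem_unionNeighborSet_diff_compl]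
    constructor
    · rintro ⟨hv, _, rfl, hadj⟩
      exact ⟨hv, G.cutMatrix_ne_zero.2 hadj.symm⟩
    · rintro ⟨hv, hne⟩
      exact ⟨hv, y, rfl, (G.cutMatrix_ne_zero.1 hne).symm⟩
  · intro w _ w' _ hww
    ext x
    have h2 : ∀ p q : ZMod 2, (p ≠ 0 ↔ q ≠ 0) → p = q := by decide
    refine h2 _ _ ?_
    have := Set.ext_iff.1 hww x
    simpa using this

end FiniteVertices

end SimpleGraph

/-! ### Counting subspaces over GF(2) -/

section CountingSubspaces

variable {F : Type*} [Field F]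

/-- The linear map that is the identity on the coordinates in `S` and is given by the matrix `M` on
the remaining coordinates. -/
def coordinateProjection {n : ℕ} (S : Finset (Fin n))
    (M : ↥Sᶜ → S → F) : (Fin n → F) →ₗ[F] (S → F) where
  toFun v i := v i + ∑ j : ↥Sᶜ, v j * M j i
  map_add' v w := by
    ext i
    simp only [Pi.add_apply, add_mul, Finset.sum_add_distrib]
    ring
  map_smul' c v := by
    ext i
    simp [mul_add, Finset.mul_sum, mul_assoc]

/-- The images of the standard vectors span the quotient by W; let S index a basis among them and
let M express the other images in it. Then `coordinateProjection S M` computes the coordinates of a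
vector modulo W. -/
lemma exists_ker_coordinateProjection_eq {n : ℕ} (W : Submodule F (Fin n → F)) :
    ∃ (S : Finset (Fin n)) (M : ↥Sᶜ → S → F), LinearMap.ker (coordinateProjection S M) = W := by
  classical
  set e : Fin n → (Fin n → F) ⧸ W := fun i => W.mkQ (Pi.single i 1)
  have hspan : Submodule.span F (Set.range e) = ⊤ := by
    have h1 : Set.range e = W.mkQ '' Set.range fun i : Fin n => (Pi.single i 1 : Fin n → F) := by
      rw [← Set.range_comp]; rfl
    have h2 : Submodule.span F (Set.range fun i : Fin n => (Pi.single i 1 : Fin n → F)) = ⊤ := by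
      have := (Pi.basisFun F (Fin n)).span_eq
      convert this using 3
      ext i
      simp
    rw [h1, Submodule.span_image, h2, Submodule.map_top, Submodule.range_mkQ]
  obtain ⟨κ, a, ha, hsp, hli⟩ := exists_linearIndependent' F e
  have : Fintype κ := Fintype.ofInjective a ha
  set S : Finset (Fin n) := Finset.univ.image a
  have hliS : LinearIndependent F fun i : S => e i := by
    have : LinearIndepOn F e (Set.range a) := (linearIndepOn_range_iff ha e).2 hli
    have h2 : LinearIndepOn F e (S : Set (Fin n)) := by simpa [S] using this
    exact h2
  have hspS : ⊤ ≤ Submodule.span F (Set.range fun i : S => e i) := by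
    rw [← hspan, ← hsp]
    refine Submodule.span_mono ?_
    rintro _ ⟨k, rfl⟩
    exact ⟨⟨a k, by simp [S]⟩, rfl⟩
  set b := Module.Basis.mk hliS hspS
  have hb : ∀ i : S, b i = e i := fun i => by simp [b]
  refine ⟨S, fun j i => b.repr (e j) i, ?_⟩
  ext v
  have hv : W.mkQ v = ∑ i : S, (coordinateProjection S (fun j i => b.repr (e j) i) v i) • b i := by
    have h1 : v = ∑ i, v i • (Pi.single i 1 : Fin n → F) := by
      simpa using (pi_eq_sum_univ' v)
    have h2 : W.mkQ v = ∑ i, v i • e i := by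
      conv_lhs => rw [h1]
      simp [e, map_sum]
    have h3 : ∀ f : Fin n → (Fin n → F) ⧸ W, ∑ i, f i = ∑ i : S, f i + ∑ i : ↥Sᶜ, f i := by
      intro f
      rw [Finset.sum_coe_sort S f, Finset.sum_coe_sort Sᶜ f, Finset.sum_add_sum_compl]
    rw [h2, h3]
    simp only [coordinateProjection, LinearMap.coe_mk, AddHom.coe_mk, add_smul,
      Finset.sum_add_distrib, hb, Finset.sum_smul]
    congr 1
    rw [Finset.sum_comm]
    refine Finset.sum_congr rfl fun j _ => ?_
    conv_lhs => rw [← b.sum_repr (e j), Finset.smul_sum]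
    exact Finset.sum_congr rfl fun i _ => by rw [hb, mul_smul]
  rw [LinearMap.mem_ker, ← Submodule.Quotient.mk_eq_zero W, ← Submodule.mkQ_apply, hv]
  constructor
  · intro h
    simp [h]
  · intro h
    ext i
    exact Fintype.linearIndependent_iff.1 b.linearIndependent _ h i

/-- There are 2^n sets S, and for each the matrix has |S|(n - |S|) ≤ n²/4 entries. -/
lemma card_submodule_fin_fun_le (n : ℕ) :
    (Nat.card (Submodule (ZMod 2) (Fin n → ZMod 2)) : ℝ) ≤ 2 ^ (n + (n : ℝ) ^ 2 / 4) := by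
  classical
  have h1 : Nat.card (Submodule (ZMod 2) (Fin n → ZMod 2)) ≤
      Nat.card (Σ S : Finset (Fin n), (↥Sᶜ → S → ZMod 2)) :=
    Nat.card_le_card_of_surjective (fun x => LinearMap.ker (coordinateProjection x.1 x.2))
      fun W => by
        obtain ⟨S, M, h⟩ := exists_ker_coordinateProjection_eq W
        exact ⟨⟨S, M⟩, h⟩
  have h2 : ∀ S : Finset (Fin n),
      ((Fintype.card (↥Sᶜ → S → ZMod 2) : ℕ) : ℝ) ≤ 2 ^ ((n : ℝ) ^ 2 / 4) := by
    intro S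
    have hS : S.card ≤ n := by simpa using Finset.card_le_univ S
    rw [Fintype.card_fun, Fintype.card_fun, ZMod.card, Fintype.card_coe, Fintype.card_coe,
      Finset.card_compl, Fintype.card_fin, ← pow_mul]
    push_cast
    rw [← Real.rpow_natCast]
    refine Real.rpow_le_rpow_of_exponent_le one_le_two ?_
    push_cast [hS]
    nlinarith [sq_nonneg ((n : ℝ) - 2 * S.card)]
  calc (Nat.card (Submodule (ZMod 2) (Fin n → ZMod 2)) : ℝ)
      ≤ (Nat.card (Σ S : Finset (Fin n), (↥Sᶜ → S → ZMod 2)) : ℝ) := by exact_mod_cast h1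
    _ = ∑ S : Finset (Fin n), ((Fintype.card (↥Sᶜ → S → ZMod 2) : ℕ) : ℝ) := by
      rw [Nat.card_eq_fintype_card, Fintype.card_sigma]
      push_cast
      rfl
    _ ≤ ∑ _S : Finset (Fin n), (2 : ℝ) ^ ((n : ℝ) ^ 2 / 4) := Finset.sum_le_sum fun S _ => h2 S
    _ = 2 ^ (n + (n : ℝ) ^ 2 / 4) := by
      rw [Finset.sum_const, Finset.card_univ, Fintype.card_finset, Fintype.card_fin,
        Real.rpow_add two_pos, Real.rpow_natCast]
      simp

lemma card_submodule_zmod_two_le {U : Type*} [AddCommGroup U] [Module (ZMod 2) U] [Finite U] :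
    (Nat.card (Submodule (ZMod 2) U) : ℝ) ≤
      2 ^ ((Module.finrank (ZMod 2) U : ℝ) + (Module.finrank (ZMod 2) U : ℝ) ^ 2 / 4) := by
  have e : U ≃ₗ[ZMod 2] (Fin (Module.finrank (ZMod 2) U) → ZMod 2) :=
    LinearEquiv.ofFinrankEq _ _ (by simp)
  rw [Nat.card_congr (Submodule.orderIsoMapComap e).toEquiv]
  exact card_submodule_fin_fun_le _

end CountingSubspaces

namespace SimpleGraph

variable {V : Type*} (G : SimpleGraph V) [Finite V]

/-- The trace of Y is the union of the supports of all vectors in the span of the columns of Y, so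
there are at most as many traces as subspaces of the column space. -/
lemma booleanCut_le (A : Set V) : G.booleanCut A ≤ G.cutRank A + G.cutRank A ^ 2 / 4 := by
  classical
  have := Fintype.ofFinite V
  set U := Submodule.span (ZMod 2) (Set.range (G.cutMatrix A).col)
  have hcard : (G.cutTraces A).ncard ≤ Nat.card (Submodule (ZMod 2) U) := by
    rw [← Set.ncard_univ]
    set φ : Submodule (ZMod 2) U → Set V := fun W => {v | ∃ h : v ∈ A, ∃ w ∈ W, w.1 ⟨v, h⟩ ≠ 0}
    refine (Set.ncard_le_ncard (t := φ '' Set.univ) ?_ (Set.toFinite _)).trans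
      (Set.ncard_image_le (Set.toFinite _))
    rintro X ⟨-, Y, hY, rfl⟩
    let c : (Aᶜ : Set V) → U := fun y => ⟨(G.cutMatrix A).col y, Submodule.subset_span ⟨y, rfl⟩⟩
    refine ⟨Submodule.span (ZMod 2) (c '' {y | (y : V) ∈ Y}), trivial, ?_⟩
    ext v
    rw [mem_unionNeighborSet_diff_compl]
    constructor
    · rintro ⟨hv, w, hw, hne⟩
      refine ⟨hv, ?_⟩
      by_contra! hno
      apply hne
      -- If v has no neighbour in Y, evaluation at v kills the generating columns, hence their span.
      let ev : U →ₗ[ZMod 2] ZMod 2 := (LinearMap.proj (⟨v, hv⟩ : A)).comp U.subtype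
      have hle : Submodule.span (ZMod 2) (c '' {y | (y : V) ∈ Y}) ≤ LinearMap.ker ev := by
        rw [Submodule.span_le]
        rintro _ ⟨y, hy, rfl⟩
        by_contra hz
        exact hno y hy (G.cutMatrix_ne_zero (x := ⟨v, hv⟩) (y := y) |>.1 hz).symm
      exact hle hw
    · rintro ⟨hv, y, hy, hadj⟩
      exact ⟨hv, c ⟨y, hY hy⟩, Submodule.subset_span ⟨_, hy, rfl⟩,
        G.cutMatrix_ne_zero.2 hadj.symm⟩
  rw [booleanCut_eq_logb_ncard, Real.logb_le_iff_le_rpow one_lt_two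
    (by exact_mod_cast G.cutTraces_ncard_pos _), cutRank_eq_finrank_col]
  exact (Nat.cast_le.2 hcard).trans card_submodule_zmod_two_le

end SimpleGraph

/-! ### Deleting an edge of a tree -/

namespace SimpleGraph

variable {N : Type*} {T : SimpleGraph N}

lemma reachable_deleteEdges_or {u v x : N} (h : T.Reachable u x) :
    (T.deleteEdges {s(u, v)}).Reachable u x ∨ (T.deleteEdges {s(u, v)}).Reachable v x := by
  obtain ⟨p⟩ := h.symm
  clear h
  induction p with
  | nil => exact Or.inl .rfl
  | @cons x y w hxy p ih =>
    by_cases he : s(x, y) = s(w, v)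
    · rcases Sym2.eq_iff.1 he with ⟨rfl, -⟩ | ⟨rfl, -⟩
      · exact Or.inl .rfl
      · exact Or.inr .rfl
    · have hadj : (T.deleteEdges {s(w, v)}).Adj y x := by
        rw [deleteEdges_adj]
        exact ⟨hxy.symm, by rwa [Set.mem_singleton_iff, Sym2.eq_swap]⟩
      exact ih.imp (fun h => h.trans hadj.reachable) fun h => h.trans hadj.reachable

lemma exists_adj_reachable_deleteEdges {t x : N} (h : T.Reachable t x) (hne : t ≠ x) :
    ∃ s, T.Adj t s ∧ (T.deleteEdges {s(s, t)}).Reachable s x := by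
  classical
  obtain ⟨p, hp⟩ := h.exists_isPath
  cases p with
  | nil => exact absurd rfl hne
  | @cons _ s _ hadj p =>
    rw [Walk.cons_isPath_iff] at hp
    refine ⟨s, hadj, ?_⟩
    rw [reachable_deleteEdges_iff_exists_walk]
    exact ⟨p, fun he => hp.2 (p.snd_mem_support_of_mem_edges he)⟩

/-- A set whose only boundary edge is `uv` is preserved by walks avoiding `uv`. -/
lemma mem_iff_of_reachable_deleteEdges {u v : N} {S : Set N}
    (hS : ∀ y z, T.Adj y z → y ∈ S → z ∉ S → s(y, z) = s(u, v)) {x y : N}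
    (h : (T.deleteEdges {s(u, v)}).Reachable x y) : x ∈ S ↔ y ∈ S := by
  obtain ⟨p⟩ := h
  induction p with
  | nil => rfl
  | @cons x y w hxy p ih =>
    rw [← ih]
    rw [deleteEdges_adj, Set.mem_singleton_iff] at hxy
    constructor
    · intro hx
      by_contra hy
      exact hxy.2 (hS x y hxy.1 hx hy)
    · intro hy
      by_contra hx
      exact hxy.2 (Sym2.eq_swap.trans (hS y x hxy.1.symm hy hx))

end SimpleGraph

/-! ### Sides, widths and balanced edges -/

namespace DecompositionTree

open SimpleGraph

variable {V : Type*}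

lemma finite (D : DecompositionTree V) : Finite V := by
  have := D.finite_node
  exact Finite.of_equiv _ D.leaf.symm

lemma disjoint_side (D : DecompositionTree V) {u v : D.Node} (h : D.tree.Adj u v) :
    Disjoint (D.side u v) (D.side v u) := by
  rw [Set.disjoint_left]
  intro x hx hx'
  have hb := (isAcyclic_iff_forall_adj_isBridge.1 D.isTree.2) h
  rw [isBridge_iff] at hb
  have hx'' : (D.tree.deleteEdges {s(u, v)}).Reachable v (D.leaf x) := by
    rw [Sym2.eq_swap]
    exact hx'
  exact hb (Reachable.trans hx hx''.symm)

lemma exists_mem_side (D : DecompositionTree V) (t : D.Node) (x : V) (h : t ≠ D.leaf x) :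
    ∃ s ∈ D.tree.neighborSet t, x ∈ D.side s t :=
  exists_adj_reachable_deleteEdges (D.isTree.1.preconnected _ _) h

lemma side_eq (D : DecompositionTree V) {u v : D.Node} {S : Set D.Node}
    (hu : u ∈ S) (hv : v ∉ S)
    (hS : ∀ y z, D.tree.Adj y z → y ∈ S → z ∉ S → s(y, z) = s(u, v)) :
    D.side u v = {x | (D.leaf x : D.Node) ∈ S} := by
  ext x
  constructor
  · intro hx
    exact (mem_iff_of_reachable_deleteEdges hS hx).1 hu
  · intro hx
    rcases reachable_deleteEdges_or (v := v)
      (D.isTree.1.preconnected u (D.leaf x)) with h | h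
    · exact h
    · exact absurd ((mem_iff_of_reachable_deleteEdges hS h).2 hx) hv

lemma finite_values (D : DecompositionTree V) (f : Set V → ℝ) :
    {r : ℝ | ∃ u v : D.Node, D.tree.Adj u v ∧ r = f (D.side u v)}.Finite := by
  have := D.finite_node
  refine (Set.finite_range fun p : D.Node × D.Node => f (D.side p.1 p.2)).subset ?_
  rintro _ ⟨u, v, -, rfl⟩
  exact ⟨(u, v), rfl⟩

lemma le_width (D : DecompositionTree V) (f : Set V → ℝ) {u v : D.Node} (h : D.tree.Adj u v) :
    f (D.side u v) ≤ D.width f :=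
  le_csSup (D.finite_values f).bddAbove ⟨u, v, h, rfl⟩

lemma width_nonneg (D : DecompositionTree V) {f : Set V → ℝ} (hf : ∀ A, 0 ≤ f A) :
    0 ≤ D.width f := by
  refine Real.sSup_nonneg ?_
  rintro _ ⟨u, v, -, rfl⟩
  exact hf _

lemma width_le (D : DecompositionTree V) {f : Set V → ℝ} {c : ℝ} (hc : 0 ≤ c)
    (h : ∀ u v, D.tree.Adj u v → f (D.side u v) ≤ c) : D.width f ≤ c := by
  refine Real.sSup_le ?_ hc
  rintro _ ⟨u, v, huv, rfl⟩
  exact h u v huv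

lemma width_eq_zero_or_exists (D : DecompositionTree V) (f : Set V → ℝ) :
    D.width f = 0 ∨ ∃ u v, D.tree.Adj u v ∧ D.width f = f (D.side u v) := by
  rcases Set.eq_empty_or_nonempty
    {r : ℝ | ∃ u v : D.Node, D.tree.Adj u v ∧ r = f (D.side u v)} with h | h
  · left
    rw [width, h, Real.sSup_empty]
  · exact Or.inr (h.csSup_mem (D.finite_values f))

/-- Every decomposition tree has an edge both of whose sides contain at least a third of `W`. -/
lemma exists_adj_balanced (D : DecompositionTree V) (W : Set V) (hW : 2 ≤ W.ncard) :
    ∃ u v, D.tree.Adj u v ∧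
      W.ncard ≤ 3 * (W ∩ D.side u v).ncard ∧ W.ncard ≤ 3 * (W ∩ (D.side u v)ᶜ).ncard := by
  classical
  have := D.finite
  have := D.finite_node
  have := Fintype.ofFinite D.Node
  -- Every node points along an edge towards a third of W: otherwise the at most three sides around
  -- it would be too small to cover W.
  have key : ∀ t, ∃ s, D.tree.Adj t s ∧ W.ncard ≤ 3 * (W ∩ D.side s t).ncard := by
    intro t
    by_contra! hno
    have hsum : ∀ W' ⊆ W, (∀ x ∈ W', t ≠ D.leaf x) →
        W'.ncard ≤ ∑ s ∈ D.tree.neighborFinset t, (W ∩ D.side s t).ncard := by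
      intro W' hW' ht
      refine (Set.ncard_le_ncard (t := ⋃ s ∈ D.tree.neighborFinset t, W ∩ D.side s t) ?_
        (Set.toFinite _)).trans (Finset.set_ncard_biUnion_le _ _)
      intro x hx
      obtain ⟨s, hs, hxs⟩ := D.exists_mem_side t x (ht x hx)
      simp only [Set.mem_iUnion]
      exact ⟨s, by simpa using hs, hW' hx, hxs⟩
    have hle : ∀ s ∈ D.tree.neighborFinset t, 3 * (W ∩ D.side s t).ncard + 1 ≤ W.ncard :=
      fun s hs => hno s (by simpa using hs)
    have hsum2 := Finset.sum_le_sum hle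
    rw [Finset.sum_add_distrib, ← Finset.mul_sum, Finset.sum_const, Finset.sum_const] at hsum2
    have hcard : (D.tree.neighborFinset t).card = (D.tree.neighborSet t).ncard := by
      rw [Set.ncard_eq_toFinset_card', neighborFinset]
    rw [hcard] at hsum2
    by_cases hleaf : (D.tree.neighborSet t).ncard ≤ 1
    -- At a leaf only the vertex x escapes the neighbouring side; `hW` makes this loss harmless.
    · obtain ⟨x, hx⟩ := D.leaf.surjective ⟨t, hleaf⟩
      have h1 := hsum (W \ {x}) Set.sdiff_subset (by
        rintro y ⟨-, hy⟩ rfl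
        exact hy (D.leaf.injective (Subtype.ext (by simp [hx]))).symm)
      have h2 := Set.ncard_le_ncard_sdiff_add_ncard W {x}
      rw [Set.ncard_singleton] at h2
      have h3 : (D.tree.neighborSet t).ncard • W.ncard ≤ W.ncard := by
        rw [smul_eq_mul]
        nlinarith
      omega
    · have h3 : (D.tree.neighborSet t).ncard = 3 := (D.subcubic t).resolve_left hleaf
      have h1 := hsum W le_rfl (by
        rintro x - rfl
        exact hleaf (D.leaf x).2)
      rw [h3, smul_eq_mul, smul_eq_mul] at hsum2
      omega
  choose next hadj hnext using key
  -- A tree has fewer edges than nodes, so two nodes choose the same edge. They are its two ends,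
  -- and the edge is balanced.
  have hlt : Fintype.card D.tree.edgeSet < Fintype.card D.Node := by
    have := D.isTree.card_edgeFinset
    rw [edgeFinset_card] at this
    omega
  obtain ⟨t, t', hne, he⟩ := Fintype.exists_ne_map_eq_of_card_lt
    (fun t => (⟨s(t, next t), hadj t⟩ : D.tree.edgeSet)) hlt
  rcases Sym2.eq_iff.1 (congrArg Subtype.val he) with ⟨h, -⟩ | ⟨h, h'⟩
  · exact absurd h hne
  · refine ⟨next t, t, (hadj t).symm, hnext t, (hnext t').trans ?_⟩
    have h1 : D.side (next t') t' ⊆ (D.side (next t) t)ᶜ := by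
      rw [← h, h']
      exact (D.disjoint_side (h' ▸ hadj t)).subset_compl_right
    have := Set.ncard_le_ncard (Set.inter_subset_inter_right W h1) (Set.toFinite _)
    omega

end DecompositionTree

section CutFunctionWidth

variable {V : Type*} {f : Set V → ℝ}

lemma cutFunctionWidth_le_width (hf : ∀ A, 0 ≤ f A) (D : DecompositionTree V) :
    cutFunctionWidth f ≤ D.width f := by
  refine csInf_le ⟨0, ?_⟩ ⟨D, rfl⟩
  rintro _ ⟨D, rfl⟩
  exact D.width_nonneg hf

lemma le_cutFunctionWidth [Nonempty (DecompositionTree V)] {c : ℝ}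
    (h : ∀ D : DecompositionTree V, c ≤ D.width f) : c ≤ cutFunctionWidth f := by
  refine le_csInf ⟨_, Classical.arbitrary _, rfl⟩ ?_
  rintro _ ⟨D, rfl⟩
  exact h D

lemma cutFunctionWidth_eq_zero [IsEmpty (DecompositionTree V)] : cutFunctionWidth f = 0 := by
  have : {r : ℝ | ∃ D : DecompositionTree V, r = D.width f} = ∅ := by
    ext r
    simp
  rw [cutFunctionWidth, this, Real.sInf_empty]

/-- The width with respect to a function with natural values is attained and is a natural number. -/
lemma exists_width_eq_cutFunctionWidth [Nonempty (DecompositionTree V)]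
    (hf : ∀ A, ∃ n : ℕ, f A = n) :
    ∃ D : DecompositionTree V, D.width f = cutFunctionWidth f ∧
      ∃ n : ℕ, cutFunctionWidth f = n := by
  have hnat : ∀ D : DecompositionTree V, ∃ n : ℕ, D.width f = n := by
    intro D
    rcases D.width_eq_zero_or_exists f with h | ⟨u, v, -, h⟩
    · exact ⟨0, by simpa using h⟩
    · rw [h]
      exact hf _
  choose w hw using hnat
  obtain ⟨D, hD⟩ : ∃ D, ∀ D', w D ≤ w D' := by
    obtain ⟨D, hD⟩ := Nat.sInf_mem (Set.range_nonempty w)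
    exact ⟨D, fun D' => hD ▸ Nat.sInf_le ⟨D', rfl⟩⟩
  have h : IsLeast {r : ℝ | ∃ D : DecompositionTree V, r = D.width f} (w D) := by
    refine ⟨⟨D, (hw D).symm⟩, ?_⟩
    rintro _ ⟨D', rfl⟩
    rw [hw]
    exact_mod_cast hD D'
  exact ⟨D, (hw D).trans h.csInf_eq.symm, w D, h.csInf_eq⟩

end CutFunctionWidth

/-! ### Caterpillars -/

namespace Caterpillar

open SimpleGraph

/-- The nodes of the caterpillar with `n` leaves: a spine `(i, false)` and a pendant node `(i, true)`
for each inner node of the spine. -/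
abbrev Node (n : ℕ) : Type := {x : Fin n × Bool // x.2 = true → 0 < x.1.val ∧ x.1.val + 1 < n}

variable {n : ℕ}

/-- The relation between a node of the caterpillar and its parent. -/
def IsParent (x y : Node n) : Prop :=
  (x.1.1.val + 1 = y.1.1.val ∧ x.1.2 = false ∧ y.1.2 = false) ∨
    (x.1.1 = y.1.1 ∧ x.1.2 = false ∧ y.1.2 = true)

/-- The caterpillar with `n` leaves. -/
def tree (n : ℕ) : SimpleGraph (Node n) where
  Adj x y := IsParent x y ∨ IsParent y x
  symm := ⟨fun _ _ h => h.symm⟩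
  loopless := ⟨fun x h => by
    rcases h with (⟨h, -⟩ | ⟨-, h, h'⟩) | (⟨h, -⟩ | ⟨-, h, h'⟩) <;> simp_all⟩

lemma tree_adj {x y : Node n} : (tree n).Adj x y ↔ IsParent x y ∨ IsParent y x := Iff.rfl

/-- The part of the caterpillar that is cut off by the edge between a node and its parent. -/
def lower (x : Node n) : Set (Node n) :=
  if x.1.2 = true then {x} else {y | x.1.1.val ≤ y.1.1.val}

lemma mem_lower_self (x : Node n) : x ∈ lower x := by
  unfold lower
  split_ifs <;> simp

lemma parent_notMem_lower {x y : Node n} (h : IsParent x y) : x ∉ lower y := by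
  rcases h with ⟨h, -, h2⟩ | ⟨-, h1, h2⟩
  · simp [lower, h2]
    omega
  · simp only [lower, h2, if_true, Set.mem_singleton_iff]
    rintro rfl
    simp_all

/-- This yields both the acyclicity of the caterpillar and, through `DecompositionTree.side_eq`, the
sides of its edges. -/
lemma boundary_lower {x y : Node n} (h : IsParent x y) {w z : Node n} (hwz : (tree n).Adj w z)
    (hw : w ∈ lower y) (hz : z ∉ lower y) : s(w, z) = s(y, x) := by
  obtain ⟨⟨⟨i, hi⟩, a⟩, hx⟩ := x
  obtain ⟨⟨⟨j, hj⟩, b⟩, hy⟩ := y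
  obtain ⟨⟨⟨k, hk⟩, c⟩, hw'⟩ := w
  obtain ⟨⟨⟨l, hl⟩, d⟩, hz'⟩ := z
  rw [tree_adj] at hwz
  cases a <;> cases b <;> cases c <;> cases d <;>
    simp [IsParent, lower] at * <;> omega

lemma tree_reachable_root (h0 : 0 < n) (x : Node n) :
    (tree n).Reachable ⟨(⟨0, h0⟩, false), by simp⟩ x := by
  have hspine : ∀ i (hi : i < n),
      (tree n).Reachable ⟨(⟨0, h0⟩, false), by simp⟩ ⟨(⟨i, hi⟩, false), by simp⟩ := by
    intro i
    induction i with
    | zero => exact fun _ => .rfl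
    | succ i ih =>
      intro hi
      refine (ih (by omega)).trans (Adj.reachable ?_)
      exact Or.inl (Or.inl ⟨rfl, rfl, rfl⟩)
  obtain ⟨⟨⟨i, hi⟩, a⟩, hx⟩ := x
  cases a
  · exact hspine i hi
  · refine (hspine i hi).trans (Adj.reachable ?_)
    exact Or.inl (Or.inr ⟨rfl, rfl, rfl⟩)

lemma tree_isTree (h0 : 0 < n) : (tree n).IsTree := by
  refine ⟨(connected_iff _).2 ⟨fun x y =>
    (tree_reachable_root h0 x).symm.trans (tree_reachable_root h0 y),
    ⟨⟨(⟨0, h0⟩, false), by simp⟩⟩⟩, isAcyclic_iff_forall_adj_isBridge.2 ?_⟩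
  have key : ∀ {x y : Node n}, IsParent x y → (tree n).IsBridge s(y, x) := by
    intro x y h
    rw [isBridge_iff]
    intro hr
    exact parent_notMem_lower h ((mem_iff_of_reachable_deleteEdges
      (fun w z hwz hw hz => boundary_lower h hwz hw hz) hr).1 (mem_lower_self y))
  rintro x y (h | h)
  · rw [Sym2.eq_swap]
    exact key h
  · exact key h

/-- The leaf with number `i`. -/
def leafNode (i : Fin n) : Node n := ⟨(i, decide (0 < i.val ∧ i.val + 1 < n)), by simp⟩

lemma neighborSet_ncard_inner (i : Fin n) (hi : 0 < i.val ∧ i.val + 1 < n) :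
    ((tree n).neighborSet ⟨(i, false), by simp⟩).ncard = 3 := by
  obtain ⟨i, hin⟩ := i
  have : (tree n).neighborSet ⟨(⟨i, hin⟩, false), by simp⟩ =
      {⟨(⟨i - 1, by omega⟩, false), by simp⟩, ⟨(⟨i + 1, hi.2⟩, false), by simp⟩,
        ⟨(⟨i, hin⟩, true), fun _ => hi⟩} := by
    ext ⟨⟨⟨j, hj⟩, a⟩, hx⟩
    rw [mem_neighborSet, tree_adj]
    simp only at hi
    cases a <;> simp [IsParent] <;> omega
  rw [this, Set.ncard_eq_three]
  refine ⟨_, _, _, ?_, ?_, ?_, rfl⟩ <;> simp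

lemma neighborSet_ncard_leafNode (i : Fin n) :
    ((tree n).neighborSet (leafNode i)).ncard ≤ 1 := by
  rw [Set.ncard_le_one (Set.toFinite _)]
  rintro ⟨⟨⟨j, hj⟩, a⟩, hx⟩ h ⟨⟨⟨k, hk⟩, b⟩, hy⟩ h'
  rw [mem_neighborSet, tree_adj] at h h'
  obtain ⟨i, hin⟩ := i
  by_cases hi : 0 < i ∧ i + 1 < n <;> cases a <;> cases b <;>
    simp [IsParent, leafNode, hi, Fin.ext_iff] at h h' hx hy ⊢ <;> omega

lemma eq_leafNode_or (x : Node n) :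
    x = leafNode x.1.1 ∨ (0 < x.1.1.val ∧ x.1.1.val + 1 < n) ∧ x = ⟨(x.1.1, false), by simp⟩ := by
  obtain ⟨⟨i, a⟩, hx⟩ := x
  by_cases hi : 0 < i.val ∧ i.val + 1 < n <;> cases a <;> simp_all [leafNode]

/-- The caterpillar as a decomposition tree with a prescribed order of the leaves. -/
noncomputable def decompositionTree {V : Type*} (h0 : 0 < n) (e : V ≃ Fin n) :
    DecompositionTree V where
  Node := Node n
  finite_node := inferInstance
  tree := tree n
  isTree := tree_isTree h0
  subcubic x := by
    rcases eq_leafNode_or x with h | ⟨hi, h⟩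
    · rw [h]
      exact Or.inl (neighborSet_ncard_leafNode _)
    · rw [h]
      exact Or.inr (neighborSet_ncard_inner _ hi)
  leaf := e.trans (Equiv.ofBijective
    (fun i => (⟨leafNode i, neighborSet_ncard_leafNode i⟩ :
      {t : Node n // ((tree n).neighborSet t).ncard ≤ 1}))
    ⟨fun i j h => congrArg (fun t => t.1.1.1) h, fun ⟨x, hx⟩ => ⟨x.1.1, by
      rcases eq_leafNode_or x with h | ⟨hi, h⟩
      · exact Subtype.ext h.symm
      · rw [h, neighborSet_ncard_inner _ hi] at hx
        omega⟩⟩)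

/-- Each edge cuts off a single leaf or a final segment of the order; by symmetry of f initial
segments suffice. -/
lemma decompositionTree_width_le {V : Type*} (h0 : 0 < n) (e : V ≃ Fin n) {f : Set V → ℝ} {c : ℝ}
    (hc : 0 ≤ c) (hf : ∀ A, f Aᶜ = f A) (h1 : ∀ x, f {x} ≤ c)
    (h2 : ∀ m : ℕ, f {x | (e x).val < m} ≤ c) :
    (decompositionTree h0 e).width f ≤ c := by
  set D := decompositionTree h0 e
  have hlower : ∀ y : Node n, f {x | leafNode (e x) ∈ lower y} ≤ c := by
    intro y
    by_cases hy : y.1.2 = true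
    · have : {x | leafNode (e x) ∈ lower y} = {e.symm y.1.1} := by
        ext x
        simp only [lower, hy, if_true, Set.mem_singleton_iff, Set.mem_ofPred_eq,
          Equiv.eq_symm_apply]
        constructor
        · intro h
          rw [← h]
          rfl
        · rintro h
          rcases eq_leafNode_or y with h' | ⟨-, h'⟩
          · rw [h', h]
          · rw [h'] at hy
            simp at hy
      rw [this]
      exact h1 _
    · have : {x | leafNode (e x) ∈ lower y} = {x | (e x).val < y.1.1.val}ᶜ := by
        ext x
        simp [lower, hy, leafNode]
      rw [this, hf]
      exact h2 _
  have key : ∀ {x y : Node n}, IsParent x y →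
      D.side y x = {z | leafNode (e z) ∈ lower y} ∧
      D.side x y = {z | leafNode (e z) ∈ lower y}ᶜ := by
    intro x y h
    refine ⟨D.side_eq (mem_lower_self y) (parent_notMem_lower h)
      (fun w z hwz hw hz => boundary_lower h hwz hw hz), ?_⟩
    refine (D.side_eq (S := (lower y)ᶜ) (parent_notMem_lower h)
      (fun h' => h' (mem_lower_self y)) (fun w z hwz hw hz => ?_))
    exact Sym2.eq_swap.trans
      ((boundary_lower h (D.tree.adj_symm hwz) (not_not.1 hz) hw).trans Sym2.eq_swap)
  refine D.width_le hc ?_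
  rintro u v (h | h)
  · rw [(key h).2, hf]
    exact hlower _
  · rw [(key h).1]
    exact hlower _

end Caterpillar

lemma nonempty_decompositionTree {V : Type*} [Finite V] [Nonempty V] :
    Nonempty (DecompositionTree V) :=
  ⟨Caterpillar.decompositionTree Nat.card_pos (Finite.equivFin V)⟩

namespace SimpleGraph

/-! ### Comparing the two widths -/

section Comparison

variable {V : Type*} [Finite V] (G : SimpleGraph V)

lemma exists_cutRank_eq_natCast (A : Set V) : ∃ n : ℕ, G.cutRank A = n :=
  ⟨_, G.cutRank_eq_finrank_row A⟩

lemma cutRank_nonneg (A : Set V) : 0 ≤ G.cutRank A := by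
  obtain ⟨n, hn⟩ := G.exists_cutRank_eq_natCast A
  rw [hn]
  exact n.cast_nonneg

lemma logb_rankWidth_le_booleanWidth : Real.logb 2 G.rankWidth ≤ G.booleanWidth := by
  rcases isEmpty_or_nonempty (DecompositionTree V) with h | h
  -- Without vertices both widths are 0, and so is the logarithm of 0.
  · rw [rankWidth, booleanWidth, cutFunctionWidth_eq_zero, cutFunctionWidth_eq_zero,
      Real.logb_zero]
  · refine le_cutFunctionWidth fun D => ?_
    have hβ := D.width_nonneg G.booleanCut_nonneg
    have hle : G.rankWidth ≤ D.width G.cutRank := cutFunctionWidth_le_width G.cutRank_nonneg D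
    obtain ⟨-, -, n, hn⟩ := exists_width_eq_cutFunctionWidth G.exists_cutRank_eq_natCast
    rw [← rankWidth] at hn
    rcases Nat.eq_zero_or_pos n with rfl | hpos
    · rw [hn]
      simpa using hβ
    · have hpos' : 0 < G.rankWidth := by
        rw [hn]
        exact_mod_cast hpos
      rcases D.width_eq_zero_or_exists G.cutRank with h0 | ⟨u, v, huv, h0⟩
      · rw [h0] at hle
        exact absurd hle (not_le.2 hpos')
      · refine le_trans ?_ (D.le_width G.booleanCut huv)
        rw [Real.logb_le_iff_le_rpow one_lt_two hpos']
        exact (hle.trans_eq h0).trans (G.cutRank_le_two_rpow_booleanCut _)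

/-- On a tree optimal for rank-width, the bound r + r²/4 for each cut already suffices; the
remaining terms are nonnegative slack. -/
lemma booleanWidth_le : G.booleanWidth ≤
    1 / 4 * G.rankWidth ^ 2 + 5 / 4 * G.rankWidth + Real.logb 2 G.rankWidth := by
  rcases isEmpty_or_nonempty (DecompositionTree V) with h | h
  · rw [rankWidth, booleanWidth, cutFunctionWidth_eq_zero, cutFunctionWidth_eq_zero]
    simp
  · obtain ⟨D, hD, n, hn⟩ := exists_width_eq_cutFunctionWidth G.exists_cutRank_eq_natCast
    rw [← rankWidth] at hn hD
    have hr : 0 ≤ G.rankWidth := by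
      rw [hn]
      exact n.cast_nonneg
    -- Integrality excludes values strictly between 0 and 1, whose logarithm is negative.
    have hlog : 0 ≤ Real.logb 2 G.rankWidth := by
      rw [hn]
      rcases Nat.eq_zero_or_pos n with rfl | hpos
      · simp
      · exact Real.logb_nonneg one_lt_two (by exact_mod_cast hpos)
    refine (cutFunctionWidth_le_width G.booleanCut_nonneg D).trans
      (D.width_le (by positivity) fun u v huv => ?_)
    have h1 : G.cutRank (D.side u v) ≤ G.rankWidth := hD ▸ D.le_width G.cutRank huv
    have h2 := G.cutRank_nonneg (D.side u v)
    refine (G.booleanCut_le _).trans ?_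
    nlinarith [pow_le_pow_left₀ h2 h1 2]

end Comparison

/-! ### Families of paths crossing a cut -/

section Lines

lemma exists_succ_of_lt {m : ℕ} {Q : Fin m → Prop} {i j : Fin m} (hij : i < j) (hi : Q i)
    (hj : ¬ Q j) : ∃ k l : Fin m, k.val + 1 = l.val ∧ Q k ∧ ¬ Q l := by
  obtain ⟨j, hjm⟩ := j
  induction j with
  | zero => exact absurd (Fin.lt_def.1 hij) (Nat.not_lt_zero _)
  | succ j ih =>
    by_cases hQ : Q ⟨j, by omega⟩
    · exact ⟨⟨j, by omega⟩, ⟨j + 1, hjm⟩, rfl, hQ, hj⟩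
    · refine ih (by omega) ?_ hQ
      rcases lt_or_eq_of_le (Nat.lt_succ_iff.1 (Fin.lt_def.1 hij)) with h | h
      · exact h
      · exact absurd (by convert hi; exact h.symm) hQ

variable {V : Type*}

/-- If a cut separates the vertices of each of several paths that lie in pairwise distant layers,
then it is crossed by an induced matching with one edge of each path. -/
lemma exists_induced_matching_of_mixed {G : SimpleGraph V} {A : Set V} {ι : Type*} {m : ℕ}
    (P : ι → Fin m → V) (c : ι → ℕ) (hc : Function.Injective c) (layer : V → ℕ)
    (hlayer : ∀ i k, layer (P i k) = 2 * c i)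
    (hP : ∀ i (k l : Fin m), k.val + 1 = l.val → G.Adj (P i k) (P i l))
    (hG : ∀ x y, G.Adj x y → layer x ≤ layer y + 1)
    (hmixed : ∀ i, (∃ k, P i k ∈ A) ∧ ∃ k, P i k ∉ A) :
    ∃ a b : ι → V, (∀ i, a i ∈ A) ∧ (∀ i, b i ∈ Aᶜ) ∧ ∀ i j, G.Adj (a i) (b j) ↔ i = j := by
  have h : ∀ i, ∃ k l, P i k ∈ A ∧ P i l ∈ Aᶜ ∧ G.Adj (P i k) (P i l) := by
    intro i
    obtain ⟨⟨k, hk⟩, l, hl⟩ := hmixed i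
    rcases lt_trichotomy k l with hkl | rfl | hkl
    · obtain ⟨k, l, hkl, hk, hl⟩ := exists_succ_of_lt (Q := fun k => P i k ∈ A) hkl hk hl
      exact ⟨k, l, hk, hl, hP i k l hkl⟩
    · exact absurd hk hl
    · obtain ⟨l, k, hkl, hl, hk⟩ :=
        exists_succ_of_lt (Q := fun k => P i k ∉ A) hkl hl (not_not.2 hk)
      exact ⟨k, l, not_not.1 hk, hl, (hP i l k hkl).symm⟩
  choose k l hk hl hkl using h
  refine ⟨fun i => P i (k i), fun i => P i (l i), hk, hl, fun i j => ⟨fun hadj => ?_, ?_⟩⟩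
  -- The paths lie in even layers, so layers differing by at most one are equal.
  · have h1 := hG _ _ hadj
    have h2 := hG _ _ hadj.symm
    rw [hlayer, hlayer] at h1 h2
    exact hc (by omega)
  · rintro rfl
    exact hkl i

/-- If no path lies inside A, then each path whose vertex at `k₀` is in A is mixed, which gives a
third of all paths; the same holds for the complement. -/
lemma mixed_or_pure {s m : ℕ} (P : Fin s → Fin m → V) (k₀ : Fin m) {A : Set V}
    (h1 : s ≤ 3 * (Set.range (fun i => P i k₀) ∩ A).ncard)
    (h2 : s ≤ 3 * (Set.range (fun i => P i k₀) ∩ Aᶜ).ncard) :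
    s ≤ 3 * Nat.card {i // (∃ k, P i k ∈ A) ∧ ∃ k, P i k ∉ A} ∨
      (∃ i, ∀ k, P i k ∈ A) ∧ ∃ i, ∀ k, P i k ∉ A := by
  set M : Set (Fin s) := {i | (∃ k, P i k ∈ A) ∧ ∃ k, P i k ∉ A}
  have hM : Nat.card {i // (∃ k, P i k ∈ A) ∧ ∃ k, P i k ∉ A} = M.ncard := rfl
  rw [hM]
  have key : ∀ B : Set V, (∀ i, P i k₀ ∈ B → i ∈ M) →
      (Set.range (fun i => P i k₀) ∩ B).ncard ≤ M.ncard := by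
    intro B hB
    refine (Set.ncard_le_ncard (t := (fun i => P i k₀) '' M) ?_ (Set.toFinite _)).trans
      (Set.ncard_image_le (Set.toFinite _))
    rintro _ ⟨⟨i, rfl⟩, hi⟩
    exact ⟨i, hB i hi, rfl⟩
  by_contra! hno
  obtain ⟨hlt, hno⟩ := hno
  by_cases hA : ∃ i, ∀ k, P i k ∈ A
  · have := key Aᶜ fun i hi => ⟨hno hA i, k₀, hi⟩
    omega
  · push Not at hA
    have := key A fun i hi => ⟨⟨k₀, hi⟩, hA i⟩
    omega

end Lines

/-! ### Square grids -/

section SquareGrid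

lemma squareGrid_adj {n : ℕ} {x y : Fin n × Fin n} : (squareGrid n).Adj x y ↔
    ((x.1.val + 1 = y.1.val ∨ y.1.val + 1 = x.1.val) ∧ x.2 = y.2) ∨
      ((x.2.val + 1 = y.2.val ∨ y.2.val + 1 = x.2.val) ∧ x.1 = y.1) := by
  rw [squareGrid, boxProd_adj, pathGraph_adj, pathGraph_adj]

/-- Order the vertices row by row: neighbours outside the first m vertices are among the next n. -/
lemma squareGrid_rankWidth_le {n : ℕ} (hn : 0 < n) : (squareGrid n).rankWidth ≤ n := by
  have hn2 : 0 < n * n := Nat.mul_pos hn hn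
  refine (cutFunctionWidth_le_width (cutRank_nonneg _)
    (Caterpillar.decompositionTree hn2 finProdFinEquiv)).trans
    (Caterpillar.decompositionTree_width_le hn2 _ n.cast_nonneg (cutRank_compl _)
      (fun x => ((squareGrid n).cutRank_singleton_le x).trans (by exact_mod_cast hn)) fun m => ?_)
  set S : Set (Fin n × Fin n) := {y | m ≤ (finProdFinEquiv y).val ∧ (finProdFinEquiv y).val < m + n}
  have hS : S.ncard ≤ n := by
    have h1 : S.ncard ≤ (Finset.Ico m (m + n) : Set ℕ).ncard := by
      refine Set.ncard_le_ncard_of_injOn (fun y => (finProdFinEquiv y).val) ?_ ?_ (Set.toFinite _)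
      · intro y hy
        exact Finset.mem_coe.2 (Finset.mem_Ico.2 hy)
      · intro y _ y' _ h
        exact finProdFinEquiv.injective (Fin.ext h)
    rwa [Set.ncard_coe_finset, Nat.card_Ico, Nat.add_sub_cancel_left] at h1
  refine ((squareGrid n).cutRank_le_ncard (S := S) ?_).trans (by exact_mod_cast hS)
  intro x hx y hy hadj
  rw [squareGrid_adj] at hadj
  refine ⟨by simpa using hy, ?_⟩
  have hx' : x.2.val + n * x.1.val < m := by simpa using hx
  change y.2.val + n * y.1.val < m + n
  rcases hadj with ⟨h | h, h'⟩ | ⟨h | h, h'⟩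
  · rw [← h', ← h]
    nlinarith
  · rw [← h']
    nlinarith
  · rw [← h']
    omega
  · rw [← h']
    omega

lemma squareGrid_exists_induced_matching {n : ℕ} (hn : 3 ≤ n)
    (D : DecompositionTree (Fin n × Fin n)) :
    ∃ u v, D.tree.Adj u v ∧ ∃ (s : ℕ) (a b : Fin s → Fin n × Fin n), n ≤ 6 * s ∧
      (∀ i, a i ∈ D.side u v) ∧ (∀ i, b i ∈ (D.side u v)ᶜ) ∧
      ∀ i j, (squareGrid n).Adj (a i) (b j) ↔ i = j := by
  -- The number of even indices below n; a third of it is at least n/6, and `hn` makes it at least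
  -- 2.
  set s := (n + 1) / 2
  let d : Fin s → Fin n := fun i => ⟨2 * i.val, by omega⟩
  let k₀ : Fin n := ⟨0, by omega⟩
  let P : Fin s → Fin n → Fin n × Fin n := fun i k => (k, d i)
  let R : Fin s → Fin n → Fin n × Fin n := fun i k => (d i, k)
  have hinj : Function.Injective fun i => P i k₀ := by
    intro i j h
    have : 2 * i.val = 2 * j.val := congrArg (fun x => x.2.val) h
    exact Fin.ext (by omega)
  have hcard : (Set.range fun i => P i k₀).ncard = s := by
    rw [← Nat.card_coe_set_eq, Nat.card_range_of_injective hinj, Nat.card_fin]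
  obtain ⟨u, v, huv, h1, h2⟩ := D.exists_adj_balanced (Set.range fun i => P i k₀) (by omega)
  refine ⟨u, v, huv, ?_⟩
  rw [hcard] at h1 h2
  rcases mixed_or_pure P k₀ h1 h2 with h | ⟨⟨i, hi⟩, j, hj⟩
  · obtain ⟨a, b, ha, hb, hab⟩ := exists_induced_matching_of_mixed (G := squareGrid n)
      (ι := {i // (∃ k, P i k ∈ D.side u v) ∧ ∃ k, P i k ∉ D.side u v})
      (fun i => P i.1) (fun i => i.1.val) (fun i j h => Subtype.ext (Fin.ext h))
      (fun x => x.2.val) (fun _ _ => rfl)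
      (fun i k l hkl => squareGrid_adj.2 (Or.inl ⟨Or.inl hkl, rfl⟩))
      (fun x y hxy => by rw [squareGrid_adj, Fin.ext_iff] at hxy; omega) (fun i => i.2)
    let e := (Finite.equivFin {i // (∃ k, P i k ∈ D.side u v) ∧ ∃ k, P i k ∉ D.side u v}).symm
    exact ⟨_, a ∘ e, b ∘ e, by omega, fun i => ha _, fun i => hb _,
      fun i j => (hab _ _).trans e.injective.eq_iff⟩
  -- One column inside and one outside make every row mixed, so the even rows give s edges.
  · obtain ⟨a, b, ha, hb, hab⟩ := exists_induced_matching_of_mixed (G := squareGrid n)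
      (A := D.side u v) R (fun i => i.val) (fun i j h => Fin.ext h)
      (fun x => x.1.val) (fun _ _ => rfl)
      (fun i k l hkl => squareGrid_adj.2 (Or.inr ⟨Or.inl hkl, rfl⟩))
      (fun x y hxy => by rw [squareGrid_adj, Fin.ext_iff, Fin.ext_iff] at hxy; omega)
      (fun k => ⟨⟨d i, hi (d k)⟩, d j, hj (d k)⟩)
    exact ⟨s, a, b, by omega, ha, hb, hab⟩

lemma le_squareGrid_booleanWidth {n : ℕ} (hn : 3 ≤ n) :
    (n : ℝ) / 6 ≤ (squareGrid n).booleanWidth := by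
  have : Nonempty (Fin n × Fin n) := ⟨(⟨0, by omega⟩, ⟨0, by omega⟩)⟩
  have := nonempty_decompositionTree (V := Fin n × Fin n)
  refine le_cutFunctionWidth fun D => ?_
  obtain ⟨u, v, huv, s, a, b, hs, ha, hb, hab⟩ := squareGrid_exists_induced_matching hn D
  have h1 := ((squareGrid n).card_le_booleanCut a b ha hb hab).trans (D.le_width _ huv)
  rw [Nat.card_fin] at h1
  have h2 : (n : ℝ) ≤ 6 * s := by exact_mod_cast hs
  linarith

lemma le_squareGrid_rankWidth {n : ℕ} (hn : 3 ≤ n) :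
    (n : ℝ) / 6 ≤ (squareGrid n).rankWidth := by
  have : Nonempty (Fin n × Fin n) := ⟨(⟨0, by omega⟩, ⟨0, by omega⟩)⟩
  have := nonempty_decompositionTree (V := Fin n × Fin n)
  refine le_cutFunctionWidth fun D => ?_
  obtain ⟨u, v, huv, s, a, b, hs, ha, hb, hab⟩ := squareGrid_exists_induced_matching hn D
  have h1 := ((squareGrid n).card_le_cutRank_of_induced_matching a b ha hb hab).trans
    (D.le_width _ huv)
  rw [Nat.card_fin] at h1
  have h2 : (n : ℝ) ≤ 6 * s := by exact_mod_cast hs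
  linarith

lemma floor_squareGrid_rankWidth_le {n : ℕ} (hn : 3 ≤ n) :
    (⌊(squareGrid n).rankWidth / 6⌋ : ℝ) - 1 ≤ (squareGrid n).booleanWidth := by
  have h1 := Int.floor_le ((squareGrid n).rankWidth / 6)
  have h2 := squareGrid_rankWidth_le (n := n) (by omega)
  have h3 := le_squareGrid_booleanWidth hn
  linarith

end SquareGrid

/-! ### Hsu-grids -/

section HsuGrid

variable {p q : ℕ}

lemma hsuGrid_adj {x y : Fin p × Fin q} : (hsuGrid p q).Adj x y ↔
    (x.1.val + 1 = y.1.val ∧ x.2.val = y.2.val) ∨ (x.1.val ≤ y.1.val ∧ x.2.val + 1 = y.2.val) ∨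
    (y.1.val + 1 = x.1.val ∧ y.2.val = x.2.val) ∨
      (y.1.val ≤ x.1.val ∧ y.2.val + 1 = x.2.val) := by
  rw [hsuGrid, fromRel_adj]
  simp only [Fin.ext_iff, Fin.le_def, ne_eq, Prod.ext_iff]
  omega

/-- As p exceeds every difference of rows, the key orders horizontal edges lexicographically, by
column and then by decreasing row. This is the triangular order required by `card_le_cutRank`. -/
lemma hsuGrid_key_lt {i j : Fin p} {k l k' l' : Fin q} (hk : k.val + 1 = k'.val)
    (hl : l.val + 1 = l'.val) (hij : i ≠ j) (hadj : (hsuGrid p q).Adj (i, k) (j, l')) :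
    (p : ℤ) * l.val - j.val < p * k.val - i.val := by
  rw [hsuGrid_adj] at hadj
  have hi := i.2
  have hj := j.2
  have hij' : i.val ≠ j.val := fun h => hij (Fin.ext h)
  simp only at hadj
  rcases hadj with ⟨h1, h2⟩ | ⟨h1, h2⟩ | ⟨h1, h2⟩ | ⟨h1, h2⟩
  · rw [h2, ← hl]
    push_cast
    rw [mul_add]
    omega
  · obtain rfl : k = l := Fin.ext (by omega)
    omega
  · rw [← h2, ← hl]
    push_cast
    rw [mul_add]
    omega
  · rw [← h2, ← hl]
    push_cast
    rw [mul_add, mul_add]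
    omega

/-- Each row changes sides between columns c and c', so it contributes a horizontal crossing edge;
these edges are triangular with respect to the key. If c is on the right, the key changes sign. -/
lemma le_hsuGrid_cutRank_of_pure {A : Set (Fin p × Fin q)} {c c' : Fin q}
    (hc : ∀ i, (i, c) ∈ A) (hc' : ∀ i, (i, c') ∉ A) : (p : ℝ) ≤ (hsuGrid p q).cutRank A := by
  rcases Nat.eq_zero_or_pos p with rfl | hp
  · simpa using cutRank_nonneg _ A
  have hne : c ≠ c' := by
    rintro rfl
    exact hc' ⟨0, hp⟩ (hc _)
  suffices h : (Nat.card (Fin p) : ℝ) ≤ (hsuGrid p q).cutRank A by rwa [Nat.card_fin] at h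
  rcases lt_or_gt_of_ne hne with h | h
  · have := fun i : Fin p =>
      exists_succ_of_lt (Q := fun k => (i, k) ∈ A) h (hc i) (hc' i)
    choose k k' hk hA hB using this
    exact card_le_cutRank _ (fun i => (i, k i)) (fun i => (i, k' i))
      (fun i => (p : ℤ) * (k i).val - i.val) hA hB
      (fun i => hsuGrid_adj.2 (Or.inr (Or.inl ⟨le_rfl, hk i⟩)))
      fun i j hij hadj => hsuGrid_key_lt (hk i) (hk j) hij hadj
  · have := fun i : Fin p =>
      exists_succ_of_lt (Q := fun k => (i, k) ∉ A) h (hc' i) (not_not.2 (hc i))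
    choose k k' hk hB hA using this
    exact card_le_cutRank _ (fun i => (i, k' i)) (fun i => (i, k i))
      (fun i => -((p : ℤ) * (k i).val - i.val)) (fun i => not_not.1 (hA i)) hB
      (fun i => hsuGrid_adj.2 (Or.inr (Or.inr (Or.inr ⟨le_rfl, hk i⟩))))
      fun i j hij hadj => neg_lt_neg (hsuGrid_key_lt (hk j) (hk i) hij.symm hadj.symm)

lemma le_hsuGrid_rankWidth (hp : 0 < p) : (p : ℝ) ≤ (hsuGrid p (6 * p)).rankWidth := by
  have : Nonempty (Fin p × Fin (6 * p)) := ⟨(⟨0, by omega⟩, ⟨0, by omega⟩)⟩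
  have := nonempty_decompositionTree (V := Fin p × Fin (6 * p))
  refine le_cutFunctionWidth fun D => ?_
  -- Sampling 3p columns makes a third of them exactly p.
  let d : Fin (3 * p) → Fin (6 * p) := fun i => ⟨2 * i.val, by omega⟩
  let k₀ : Fin p := ⟨0, hp⟩
  let P : Fin (3 * p) → Fin p → Fin p × Fin (6 * p) := fun i k => (k, d i)
  have hinj : Function.Injective fun i => P i k₀ := by
    intro i j h
    have : 2 * i.val = 2 * j.val := congrArg (fun x => x.2.val) h
    exact Fin.ext (by omega)
  have hcard : (Set.range fun i => P i k₀).ncard = 3 * p := by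
    rw [← Nat.card_coe_set_eq, Nat.card_range_of_injective hinj, Nat.card_fin]
  obtain ⟨u, v, huv, h1, h2⟩ := D.exists_adj_balanced (Set.range fun i => P i k₀) (by omega)
  refine le_trans ?_ (D.le_width _ huv)
  rw [hcard] at h1 h2
  rcases mixed_or_pure P k₀ h1 h2 with h | ⟨⟨i, hi⟩, j, hj⟩
  · obtain ⟨a, b, ha, hb, hab⟩ := exists_induced_matching_of_mixed (G := hsuGrid p (6 * p))
      (ι := {i // (∃ k, P i k ∈ D.side u v) ∧ ∃ k, P i k ∉ D.side u v})
      (fun i => P i.1) (fun i => i.1.val) (fun i j h => Subtype.ext (Fin.ext h))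
      (fun x => x.2.val) (fun _ _ => rfl)
      (fun i k l hkl => hsuGrid_adj.2 (Or.inl ⟨hkl, rfl⟩))
      (fun x y hxy => by rw [hsuGrid_adj] at hxy; omega) (fun i => i.2)
    refine le_trans ?_ (card_le_cutRank_of_induced_matching _ a b ha hb hab)
    exact_mod_cast (by omega)
  · exact le_hsuGrid_cutRank_of_pure hi hj

lemma exists_forall_iff_lt {Q : ℕ → Prop} (hQ : ∀ a b, a ≤ b → Q b → Q a)
    (hlt : ∀ a, Q a → a < p) : ∃ s : Fin (p + 1), ∀ a, Q a ↔ a < s.val := by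
  classical
  have hex : ∃ a, ¬ Q a := ⟨p, fun h => lt_irrefl _ (hlt p h)⟩
  refine ⟨⟨Nat.find hex, Nat.lt_succ_iff.2 (Nat.find_le fun h => lt_irrefl _ (hlt p h))⟩,
    fun a => ⟨fun ha => ?_, fun ha => not_not.1 (Nat.find_min hex ha)⟩⟩
  by_contra hle
  exact Nat.find_spec hex (hQ _ _ (not_lt.1 hle) ha)

/-- The number of traces of a cut between two initial segments of the column-by-column order. -/
lemma hsuGrid_cutTraces_ncard_le (i j : ℕ) :
    ((hsuGrid p q).cutTraces {x | x.2.val < j ∨ (x.2.val = j ∧ x.1.val < i)}).ncard ≤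
      2 * (p + 1) ^ 2 := by
  set A : Set (Fin p × Fin q) := {x | x.2.val < j ∨ (x.2.val = j ∧ x.1.val < i)} with hA
  -- Column j sees column j + 1 in an initial segment of rows, and column j - 1 sees column j
  -- likewise; the bit records the vertical edge from the last vertex of A in column j.
  let φ : Fin (p + 1) × Fin (p + 1) × Bool → Set (Fin p × Fin q) := fun z =>
    {x | x ∈ A ∧ ((x.2.val = j ∧ x.1.val < z.1.val) ∨ (x.2.val + 1 = j ∧ x.1.val < z.2.1.val) ∨
      (z.2.2 = true ∧ x.2.val = j ∧ x.1.val + 1 = i))}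
  have hcard : (Set.range φ).ncard ≤ 2 * (p + 1) ^ 2 := by
    rw [← Set.image_univ]
    refine (Set.ncard_image_le (Set.toFinite _)).trans ?_
    rw [Set.ncard_univ, Nat.card_prod, Nat.card_prod, Nat.card_fin, Nat.card_eq_fintype_card,
      Fintype.card_bool]
    exact le_of_eq (by ring)
  refine (Set.ncard_le_ncard ?_ (Set.toFinite _)).trans hcard
  rintro X ⟨-, Y, hY, rfl⟩
  have hseg : ∀ c : ℕ, ∃ s : Fin (p + 1),
      ∀ a, (∃ y ∈ Y, y.2.val = c ∧ a ≤ y.1.val) ↔ a < s.val := by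
    intro c
    refine exists_forall_iff_lt ?_ ?_
    · rintro a b hab ⟨y, hy, hc, hb⟩
      exact ⟨y, hy, hc, hab.trans hb⟩
    · rintro a ⟨y, -, -, ha⟩
      exact ha.trans_lt y.1.2
  obtain ⟨s, hs⟩ := hseg (j + 1)
  obtain ⟨t, ht⟩ := hseg j
  classical
  refine ⟨(s, t, decide (∃ y ∈ Y, y.2.val = j ∧ y.1.val = i)), ?_⟩
  ext x
  rw [mem_unionNeighborSet_diff_compl]
  refine and_congr_right fun hx => ?_
  simp only [← hs, ← ht, decide_eq_true_eq]
  have hY' : ∀ y ∈ Y, ¬ (y.2.val < j ∨ (y.2.val = j ∧ y.1.val < i)) := fun y hy => hY hy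
  have hx' : x.2.val < j ∨ (x.2.val = j ∧ x.1.val < i) := hx
  constructor
  · rintro (⟨h, y, hy, hc, hr⟩ | ⟨h, y, hy, hc, hr⟩ | ⟨⟨y, hy, hc, hr⟩, h, h'⟩) <;>
      exact ⟨y, hy, hsuGrid_adj.2 (by omega)⟩
  · rintro ⟨y, hy, hadj⟩
    have hy' := hY' y hy
    rw [hsuGrid_adj] at hadj
    by_cases h1 : x.2.val = j
    · by_cases h2 : y.2.val = j
      · exact Or.inr (Or.inr ⟨⟨y, hy, h2, by omega⟩, h1, by omega⟩)
      · exact Or.inl ⟨h1, y, hy, by omega, by omega⟩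
    · exact Or.inr (Or.inl ⟨by omega, y, hy, by omega, by omega⟩)

lemma hsuGrid_booleanWidth_le (hp : 0 < p) (hq : 0 < q) :
    (hsuGrid p q).booleanWidth ≤ Real.logb 2 (2 * (p + 1) ^ 2) := by
  have h0 : 0 < q * p := Nat.mul_pos hq hp
  have hp' : (1 : ℝ) ≤ p := by exact_mod_cast hp
  have h1 : (1 : ℝ) ≤ Real.logb 2 (2 * (p + 1) ^ 2) := by
    rw [Real.le_logb_iff_rpow_le one_lt_two (by positivity)]
    simp only [Real.rpow_one]
    nlinarith
  refine (cutFunctionWidth_le_width (booleanCut_nonneg _)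
    (Caterpillar.decompositionTree h0 ((Equiv.prodComm _ _).trans finProdFinEquiv))).trans
    (Caterpillar.decompositionTree_width_le h0 _ (zero_le_one.trans h1) (booleanCut_compl _)
      (fun x => (booleanCut_singleton_le _ x).trans h1) fun m => ?_)
  -- The first m vertices are m / p full columns and m % p vertices of the next.
  have hset : {x : Fin p × Fin q |
      (((Equiv.prodComm _ _).trans finProdFinEquiv) x).val < m} =
      {x | x.2.val < m / p ∨ (x.2.val = m / p ∧ x.1.val < m % p)} := by
    ext x
    change x.1.val + p * x.2.val < m ↔ x.2.val < m / p ∨ (x.2.val = m / p ∧ x.1.val < m % p)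
    have hx := x.1.2
    have hm := Nat.div_add_mod m p
    have hmod := Nat.mod_lt m hp
    rcases lt_trichotomy x.2.val (m / p) with h | h | h
    · have := Nat.mul_le_mul_left p (Nat.succ_le_of_lt h)
      rw [Nat.mul_succ] at this
      omega
    · rw [h]
      omega
    · have := Nat.mul_le_mul_left p (Nat.succ_le_of_lt h)
      rw [Nat.mul_succ] at this
      omega
  rw [hset, booleanCut_eq_logb_ncard]
  refine Real.logb_le_logb_of_le one_lt_two (by exact_mod_cast cutTraces_ncard_pos _ _) ?_
  exact_mod_cast hsuGrid_cutTraces_ncard_le (m % p) (m / p)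

lemma hsuGrid_booleanWidth_le_rankWidth (hp : 0 < p) :
    (hsuGrid p (6 * p)).booleanWidth ≤ 2 * Real.logb 2 (hsuGrid p (6 * p)).rankWidth + 4 := by
  have hp' : (1 : ℝ) ≤ p := by exact_mod_cast hp
  have h1 := hsuGrid_booleanWidth_le hp (q := 6 * p) (by omega)
  -- 2(p + 1)² ≤ 16p² turns the count of traces into 2 log p + 4.
  have h2 : Real.logb 2 (2 * (p + 1) ^ 2) ≤ Real.logb 2 ((p : ℝ) ^ 2 * 2 ^ 4) :=
    Real.logb_le_logb_of_le one_lt_two (by positivity) (by nlinarith)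
  rw [Real.logb_mul (x := (p : ℝ) ^ 2) (by positivity) (by positivity), Real.logb_pow,
    Real.logb_pow, Real.logb_self_eq_one one_lt_two] at h2
  have h3 := Real.logb_le_logb_of_le one_lt_two (by positivity) (le_hsuGrid_rankWidth hp)
  push_cast at h2
  linarith

end HsuGrid

end SimpleGraph

theorem theorem1 :
    (∀ (V : Type*) [Finite V] (G : SimpleGraph V),
      Real.logb 2 G.rankWidth ≤ G.booleanWidth ∧
      G.booleanWidth ≤
        1 / 4 * G.rankWidth ^ 2 + 5 / 4 * G.rankWidth + Real.logb 2 G.rankWidth) ∧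
    (∃ K : ℕ, ∀ k : ℕ, K ≤ k →
      (∃ p q : ℕ, 2 ≤ p ∧ 2 ≤ q ∧
        (k : ℝ) ≤ (SimpleGraph.hsuGrid p q).rankWidth ∧
        (SimpleGraph.hsuGrid p q).booleanWidth ≤
          2 * Real.logb 2 (SimpleGraph.hsuGrid p q).rankWidth + 4) ∧
      (∃ n : ℕ,
        (k : ℝ) ≤ (SimpleGraph.squareGrid n).rankWidth ∧
        (⌊(SimpleGraph.squareGrid n).rankWidth / 6⌋ : ℝ) - 1 ≤
          (SimpleGraph.squareGrid n).booleanWidth) ∧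
      (⌊(SimpleGraph.squareGrid k).rankWidth / 6⌋ : ℝ) - 1 ≤
        (SimpleGraph.squareGrid k).booleanWidth) := by
  -- The bound 3 comes from the square grid lemmas; side 6k is needed because rank-width is only
  -- known to be at least a sixth of the side.
  refine ⟨fun V _ G => ⟨G.logb_rankWidth_le_booleanWidth, G.booleanWidth_le⟩, 3, fun k hk =>
    ⟨⟨k, 6 * k, by omega, by omega, SimpleGraph.le_hsuGrid_rankWidth (by omega),
      SimpleGraph.hsuGrid_booleanWidth_le_rankWidth (by omega)⟩, ⟨6 * k, ?_,
      SimpleGraph.floor_squareGrid_rankWidth_le (by omega)⟩,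
      SimpleGraph.floor_squareGrid_rankWidth_le hk⟩⟩
  have h := SimpleGraph.le_squareGrid_rankWidth (n := 6 * k) (by omega)
  push_cast at h
  linarith
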